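/- Let $D$ be an infinite digraph without loops or multiple edges (opposite edges $vw$, $wv$ are allowed). For vertex sets $A,B$ let $E(A,B)$ be the set of edges of $D$ from $A$ to $B$, and write $E(v,B)$, $E(A,v)$ when $A$ or $B$ is $\{v\}$. A *ray* is a one-way infinite directed path with a first vertex. A ray is *solid* if for every finite $X\subseteq V(D)$ it has a tail in some strong component of $D-X$. Two solid rays are *equivalent* if for every finite $X\subseteq V(D)$ they have a tail in the same strong component of $D-X$. The equivalence classes are the *ends* of $D$. For an end $\omega$ and a finite set $X$, let $C(X,\omega)$ be the unique strong component of $D-X$ that contains a tail of every ray in $\omega$. The set $X$ *separates* ends $\omega,\eta$ if $C(X,\omega)\neq C(X,\eta)$. A *limit edge* of $D$ is one of the following, where $\omega,\eta$ are ends and $v$ is a vertex: - a pair $\omega\eta$ with $\omega\ne\eta$ such that $E(C(X,\omega),C(X,\eta))\neq\emptyset$ for every finite $X$ separating $\omega$ and $\eta$; - a pair $v\omega$ such that $E(v,C(X,\omega))\ne\emptyset$ for every finite $X$ with $v\notin C(X,\omega)$; - a pair $\omega v$ such that $E(C(X,\omega),v)\ne\emptyset$ for every finite $X$ with $v\notin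 C(X,\omega)$. For a finite $X\subseteq V(D)$, a *bundle* of $D-X$ is a non-empty edge set of the form $E(C,C')$, $E(v,C)$ or $E(C,v)$, where $C\ne C'$ are strong components of $D-X$ and $v\in X$. A *direction* of $D$ is a map $f$ that sends every finite $X\subseteq V(D)$ to a strong component or a bundle of $D-X$ so that $f(X)\supseteq f(Y)$ whenever $X\subseteq Y$. Here two strong components are compared as subdigraphs, and a strong component is compared with a bundle through its set of edges. An *edge-direction* is a direction that sends some finite $X$ to a bundle of $D-X$. Every limit edge $\lambda$ defines a map $f_\lambda$ on the finite vertex sets $X$ of $D$. If $\lambda=\omega\eta$, then $f_\lambda(X)=E(C(X,\omega),C(X,\eta))$ if $X$ separates $\omega$ and $\eta$, and $f_\lambda(X)=C(X,\omega)=C(X,\eta)$ otherwise. If $\lambda=v\omega$ or $\lambda=\omega v$, then $f_\lambda(X)=C(X,\omega)$ if $v\in C(X,\omega)$. If $v\notin C(X,\omega)$, let $S$ be $\{v\}$ if $v\in X$ and the strong component of $D-X$ containing $v$ otherwise; then $f_{v\omega}(X)=E(S,C(X,\omega))$ and $f_{\omega v}(X)=E(C(X,\omega),S)$. **Theorem.**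 Each $f_\lambda$ is an edge-direction of $D$, and the map $\lambda\mapsto f_\lambda$ is a bijection from the set of limit edges of $D$ onto the set of edge-directions of $D$. -/

import Mathlib

namespace Digraph

universe u

/-- `D.Reach X v w`: there is a (possibly trivial) directed walk from `v` to `w` all of whose edges
are edges of `D - X`. -/
def Reach {V : Type u} (D : Digraph V) (X : Finset V) : V → V → Prop :=
  Relation.ReflTransGen fun a b => a ∉ X ∧ b ∉ X ∧ D.Adj a b

/-- The vertex set of the strong component of `D - X` that contains `v`
(meaningful for vertices `v ∉ X`). -/
def strongComponentOf {V : Type u} (D : Digraph V) (X : Finset V) (v : V) : Set V :=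
  {w | w ∉ X ∧ D.Reach X v w ∧ D.Reach X w v}

/-- `C` is the vertex set of a strong component of `D - X`. The strong component itself is the
subdigraph of `D` induced on `C`. -/
def IsStrongComponent {V : Type u} (D : Digraph V) (X : Finset V) (C : Set V) : Prop :=
  ∃ v, v ∉ X ∧ C = D.strongComponentOf X v

/-- The set `E(A, B)` of all edges of `D` from `A` to `B`. -/
def edgesBetween {V : Type u} (D : Digraph V) (A B : Set V) : Set (V × V) :=
  {e | e.1 ∈ A ∧ e.2 ∈ B ∧ D.Adj e.1 e.2}

theorem IsStrongComponent.eq_of_mem {V : Type u} {D : Digraph V} {X : Finset V} {C C' : Set V}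
    (hC : D.IsStrongComponent X C) (hC' : D.IsStrongComponent X C') {w : V}
    (hw : w ∈ C) (hw' : w ∈ C') : C = C' := by
  obtain ⟨a, -, rfl⟩ := hC
  obtain ⟨b, -, rfl⟩ := hC'
  ext x
  constructor
  · rintro ⟨hx, h1, h2⟩
    exact ⟨hx, (hw'.2.1.trans hw.2.2).trans h1, h2.trans (hw.2.1.trans hw'.2.2)⟩
  · rintro ⟨hx, h1, h2⟩
    exact ⟨hx, (hw.2.1.trans hw'.2.2).trans h1, h2.trans (hw'.2.1.trans hw.2.2)⟩

/-- A (directed) ray of `D`: a one-way infinite directed path with a first vertex. -/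
structure Ray {V : Type u} (D : Digraph V) where
  vert : ℕ → V
  injective : Function.Injective vert
  adj : ∀ n, D.Adj (vert n) (vert (n + 1))

/-- The ray `R` has a tail in (the subdigraph induced on) `C`. -/
def Ray.HasTailIn {V : Type u} {D : Digraph V} (R : D.Ray) (C : Set V) : Prop :=
  ∃ N, ∀ n, N ≤ n → R.vert n ∈ C

/-- A ray is solid if, for every finite `X`, it has a tail in some strong component of `D - X`. -/
def Ray.IsSolid {V : Type u} {D : Digraph V} (R : D.Ray) : Prop :=
  ∀ X : Finset V, ∃ C, D.IsStrongComponent X C ∧ R.HasTailIn C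

/-- The solid rays of `D`. -/
def SolidRay {V : Type u} (D : Digraph V) : Type u :=
  {R : D.Ray // R.IsSolid}

/-- Two solid rays are equivalent if, for every finite `X`, they have a tail in the same strong
component of `D - X`. -/
def SolidRay.Equivalent {V : Type u} {D : Digraph V} (R S : D.SolidRay) : Prop :=
  ∀ X : Finset V, ∃ C, D.IsStrongComponent X C ∧ R.1.HasTailIn C ∧ S.1.HasTailIn C

theorem Ray.HasTailIn.eq {V : Type u} {D : Digraph V} {R : D.Ray} {X : Finset V} {C C' : Set V}
    (hC : D.IsStrongComponent X C) (hC' : D.IsStrongComponent X C')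
    (h : R.HasTailIn C) (h' : R.HasTailIn C') : C = C' := by
  obtain ⟨N, hN⟩ := h
  obtain ⟨M, hM⟩ := h'
  exact hC.eq_of_mem hC' (hN _ (le_max_left N M)) (hM _ (le_max_right N M))

instance solidRaySetoid {V : Type u} (D : Digraph V) : Setoid D.SolidRay where
  r := SolidRay.Equivalent
  iseqv :=
    { refl := fun R X => by
        obtain ⟨C, hC, h⟩ := R.2 X
        exact ⟨C, hC, h, h⟩
      symm := fun h X => by
        obtain ⟨C, hC, h1, h2⟩ := h X
        exact ⟨C, hC, h2, h1⟩
      trans := fun h h' X => by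
        obtain ⟨C, hC, h1, h2⟩ := h X
        obtain ⟨C', hC', h3, h4⟩ := h' X
        obtain rfl := Ray.HasTailIn.eq hC hC' h2 h3
        exact ⟨C, hC, h1, h4⟩ }

/-- The ends of `D`: the equivalence classes of solid rays. -/
def End {V : Type u} (D : Digraph V) : Type u :=
  Quotient D.solidRaySetoid

/-- The end `ω` lives in `C`: every solid ray that represents `ω` has a tail in `C`. -/
def End.LivesIn {V : Type u} {D : Digraph V} (ω : D.End) (C : Set V) : Prop :=
  ∀ R : D.SolidRay, Quotient.mk D.solidRaySetoid R = ω → R.1.HasTailIn C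

theorem End.existsUnique_livesIn {V : Type u} {D : Digraph V} (ω : D.End) (X : Finset V) :
    ∃! C : Set V, D.IsStrongComponent X C ∧ ω.LivesIn C := by
  induction ω using Quotient.inductionOn with
  | h R =>
    obtain ⟨C, hC, hR⟩ := R.2 X
    refine ⟨C, ⟨hC, fun S hS => ?_⟩, ?_⟩
    · have hSR : SolidRay.Equivalent S R := Quotient.exact hS
      obtain ⟨C', hC', h1, h2⟩ := hSR X
      obtain rfl := Ray.HasTailIn.eq hC hC' hR h2
      exact h1
    · rintro C' ⟨hC', hl⟩
      exact Ray.HasTailIn.eq hC' hC (hl R rfl) hR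

/-- `C(X, ω)`: the strong component of `D - X` in which the end `ω` lives. -/
noncomputable def End.component {V : Type u} {D : Digraph V} (ω : D.End) (X : Finset V) : Set V :=
  Classical.choose (ω.existsUnique_livesIn X).exists

theorem End.component_spec {V : Type u} {D : Digraph V} (ω : D.End) (X : Finset V) :
    D.IsStrongComponent X (ω.component X) ∧ ω.LivesIn (ω.component X) :=
  Classical.choose_spec (ω.existsUnique_livesIn X).exists

/-- The finite vertex set `X` separates the ends `ω` and `η`. -/
def Separates {V : Type u} {D : Digraph V} (X : Finset V) (ω η : D.End) : Prop :=
  ω.component X ≠ η.component X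

/-- The limit edges of `D`: from an end to another end, from a vertex to an end, or from an end to
a vertex. -/
inductive LimitEdge {V : Type u} (D : Digraph V) : Type u
  | endEnd (ω η : D.End) (hne : ω ≠ η)
      (h : ∀ X : Finset V, Separates X ω η →
        (D.edgesBetween (ω.component X) (η.component X)).Nonempty) : LimitEdge D
  | vertexEnd (v : V) (ω : D.End)
      (h : ∀ X : Finset V, v ∉ ω.component X →
        (D.edgesBetween {v} (ω.component X)).Nonempty) : LimitEdge D
  | endVertex (ω : D.End) (v : V)
      (h : ∀ X : Finset V, v ∉ ω.component X →
        (D.edgesBetween (ω.component X) {v}).Nonempty) : LimitEdge D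

/-- `F` is a bundle of `D - X`: a non-empty set consisting of all the edges from `C` to `C'`, from
`v` to `C`, or from `C` to `v`, for distinct strong components `C`, `C'` of `D - X` and a vertex
`v ∈ X`. -/
def IsBundle {V : Type u} (D : Digraph V) (X : Finset V) (F : Set (V × V)) : Prop :=
  F.Nonempty ∧
    ((∃ C C', D.IsStrongComponent X C ∧ D.IsStrongComponent X C' ∧ C ≠ C' ∧
        F = D.edgesBetween C C') ∨
      (∃ v C, v ∈ X ∧ D.IsStrongComponent X C ∧ F = D.edgesBetween {v} C) ∨
      (∃ C v, v ∈ X ∧ D.IsStrongComponent X C ∧ F = D.edgesBetween C {v}))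

/-- The possible values of a direction: a strong component, given by its vertex set, or a bundle,
given as a set of edges. -/
inductive DirectionValue (V : Type u) : Type u
  | component (C : Set V) : DirectionValue V
  | bundle (F : Set (V × V)) : DirectionValue V

/-- `D.Contains a b` is the relation `a ⊇ b` between values of a direction. Two strong components
are compared as (induced) subdigraphs, that is, through their vertex sets; as soon as a bundle is
involved, a strong component is identified with its set of edges. -/
def Contains {V : Type u} (D : Digraph V) : DirectionValue V → DirectionValue V → Prop
  | .component C, .component C' => C' ⊆ C
  | .component C, .bundle F => F ⊆ D.edgesBetween C C
  | .bundle F, .component C => D.edgesBetween C C ⊆ F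
  | .bundle F, .bundle F' => F' ⊆ F

/-- The value `a` is a strong component or a bundle of `D - X`. -/
def IsComponentOrBundle {V : Type u} (D : Digraph V) (X : Finset V) :
    DirectionValue V → Prop
  | .component C => D.IsStrongComponent X C
  | .bundle F => D.IsBundle X F

/-- A direction of `D` maps every finite vertex set `X` to a strong component or a bundle of
`D - X`, so that `f X ⊇ f Y` whenever `X ⊆ Y`. -/
def IsDirection {V : Type u} (D : Digraph V) (f : Finset V → DirectionValue V) : Prop :=
  (∀ X, D.IsComponentOrBundle X (f X)) ∧ ∀ X Y, X ⊆ Y → D.Contains (f X) (f Y)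

/-- The edge-directions of `D`: the directions that map some finite vertex set to a bundle. -/
def edgeDirections {V : Type u} (D : Digraph V) : Set (Finset V → DirectionValue V) :=
  {f | D.IsDirection f ∧ ∃ X F, f X = .bundle F}

open Classical in
/-- The side of the bundle `E(X, vω)` or `E(X, ωv)` that belongs to the vertex `v`: the vertex `v`
itself if `v ∈ X`, and otherwise the strong component of `D - X` that contains `v`. -/
noncomputable def vertexSide {V : Type u} (D : Digraph V) (X : Finset V) (v : V) : Set V :=
  if v ∈ X then {v} else D.strongComponentOf X v

open Classical in
/-- The map `f_λ` defined by a limit edge `λ`: it maps every finite vertex set `X` to the bundle or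
strong component of `D - X` in which `λ` lives. -/
noncomputable def LimitEdge.direction {V : Type u} {D : Digraph V} :
    D.LimitEdge → Finset V → DirectionValue V
  | .endEnd ω η _ _, X =>
      if Separates X ω η then .bundle (D.edgesBetween (ω.component X) (η.component X))
      else .component (ω.component X)
  | .vertexEnd v ω _, X =>
      if v ∈ ω.component X then .component (ω.component X)
      else .bundle (D.edgesBetween (D.vertexSide X v) (ω.component X))
  | .endVertex ω v _, X =>
      if v ∈ ω.component X then .component (ω.component X)
      else .bundle (D.edgesBetween (ω.component X) (D.vertexSide X v))

end Digraph

/-! For each finite `X`, the vertices of `X` and the strong components of `D - X` partition the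
vertex set into parts, and these parts refine as `X` grows. Ends and vertices are treated together
as points, and a point picks one part for each `X`. Distinct points are eventually separated and
then stay separated. In these terms a limit edge is an ordered pair of distinct points, not both
vertices, joined by an edge whenever they lie in different parts, and `direction_eq` gives one
formula for all three kinds.

Since the parts partition, one edge of a bundle determines both of its sides. Hence the bundles of
`f_λ` determine the parts of both endpoints, so the endpoints themselves: this is injectivity.

For surjectivity, an edge-direction that takes a bundle value at `X₀` takes bundle values at all
larger sets, and the two sides of these bundles form monotone families of parts. By
`exists_point_of_parts` each family comes from a point, and the two points form the limit edge.

The hard step is `exists_ray_of_haven`: a monotone choice `C` of strong components comes from a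
solid ray, even when `D` is uncountable. Finite sets `Z n` are built whose countable union is closed
under finitely many operations. A ray is found inside the union by Kőnig's lemma. The closure under
separating sets forces every `C X` to meet the union, and then walks inside the union bring the ray
into `C X`. -/

namespace Digraph

universe u

/-! ### Kőnig's lemma and finite supports of walks -/

section Konig

open Relation

variable {α : Type*} {r : α → α → Prop}

theorem reflTransGen_eq_or_exists_avoiding {a x : α} (h : ReflTransGen r a x) :
    x = a ∨ ∃ b, b ≠ a ∧ r a b ∧ ReflTransGen (fun y z => r y z ∧ y ≠ a ∧ z ≠ a) b x := by
  induction h with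
  | refl => exact Or.inl rfl
  | @tail y z hy hyz ih =>
    by_cases hz : z = a
    · exact Or.inl hz
    right
    rcases ih with rfl | ⟨b, hb, hab, hby⟩
    · exact ⟨z, hz, hyz, .refl⟩
    · rcases eq_or_ne y a with rfl | hya
      · exact ⟨z, hz, hyz, .refl⟩
      · exact ⟨b, hb, hab, hby.tail ⟨hyz, hya, hz⟩⟩

/-- A walk from `a` can be cut at its last visit to `a`, so everything reached, apart from `a`, is
reached from one of finitely many successors without returning to `a`. One successor must reach
infinitely much. -/
theorem exists_step_infinite_reach (hfin : ∀ a, {b | r a b}.Finite) (A : Set α) (a : α)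
    (hinf : {x | ReflTransGen (fun y z => r y z ∧ y ∉ A ∧ z ∉ A) a x}.Infinite) :
    ∃ b, r a b ∧ b ∉ insert a A ∧
      {x | ReflTransGen (fun y z => r y z ∧ y ∉ insert a A ∧ z ∉ insert a A) b x}.Infinite := by
  by_contra! hcon
  refine hinf ?_
  have hsub : {x | ReflTransGen (fun y z => r y z ∧ y ∉ A ∧ z ∉ A) a x} ⊆
      {a} ∪ ⋃ b ∈ {b | r a b ∧ b ∉ insert a A},
        {x | ReflTransGen (fun y z => r y z ∧ y ∉ insert a A ∧ z ∉ insert a A) b x} := by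
    intro x hx
    rcases reflTransGen_eq_or_exists_avoiding hx with rfl | ⟨b, hb, hab, hbx⟩
    · exact Or.inl rfl
    · right
      simp only [Set.mem_iUnion]
      refine ⟨b, ⟨hab.1, by simp [hb, hab.2.2]⟩, ReflTransGen.mono ?_ _ _ hbx⟩
      rintro y z ⟨⟨h1, h2, h3⟩, h4, h5⟩
      exact ⟨h1, by simp [h2, h4], by simp [h3, h5]⟩
  refine ((Set.finite_singleton a).union (Set.Finite.biUnion ?_ ?_)).subset hsub
  · exact (hfin a).subset fun b hb => hb.1
  · rintro b ⟨hab, hb⟩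
    exact hcon b hab hb

/-- Kőnig's lemma for relations with finite out-degrees. -/
theorem exists_injective_chain (hfin : ∀ a, {b | r a b}.Finite) {a : α}
    (hinf : {x | ReflTransGen r a x}.Infinite) :
    ∃ f : ℕ → α, Function.Injective f ∧ ∀ n, r (f n) (f (n + 1)) := by
  -- A state is the set of vertices already used and the current vertex; recording the used ones
  -- makes the chain injective.
  let P : Set α × α → Prop := fun s =>
    s.2 ∉ s.1 ∧ {x | ReflTransGen (fun y z => r y z ∧ y ∉ s.1 ∧ z ∉ s.1) s.2 x}.Infinite
  have step : ∀ s : {s // P s}, ∃ t : {s // P s},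
      t.1.1 = insert s.1.2 s.1.1 ∧ r s.1.2 t.1.2 := by
    rintro ⟨⟨A, a⟩, h1, h2⟩
    obtain ⟨b, hab, hb, hi⟩ := exists_step_infinite_reach hfin A a h2
    exact ⟨⟨(insert a A, b), hb, hi⟩, rfl, hab⟩
  choose next hnext hr using step
  have hstart : P (∅, a) := ⟨by simp, by simpa using hinf⟩
  let s : ℕ → {s // P s} := fun n => Nat.rec ⟨(∅, a), hstart⟩ (fun _ t => next t) n
  have hs : ∀ n, s (n + 1) = next (s n) := fun _ => rfl
  have hmono : ∀ n m, n < m → (s n).1.2 ∈ (s m).1.1 := by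
    intro n m h
    induction m with
    | zero => omega
    | succ m ih =>
      rw [hs, hnext]
      rcases Nat.lt_succ_iff_lt_or_eq.1 h with h | rfl
      · exact Set.mem_insert_of_mem _ (ih h)
      · exact Set.mem_insert _ _
  refine ⟨fun n => (s n).1.2, ?_, fun n => hr _⟩
  refine Function.Injective.of_lt_imp_ne fun n m h heq => (s m).2.1 ?_
  simpa [← heq] using hmono n m h

theorem exists_finset_support {a b : α} (h : ReflTransGen r a b) :
    ∃ T : Finset α, a ∈ T ∧ b ∈ T ∧ ReflTransGen (fun x y => r x y ∧ x ∈ T ∧ y ∈ T) a b := by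
  classical
  induction h with
  | refl => exact ⟨{a}, by simp, by simp, .refl⟩
  | @tail y z _ hyz ih =>
    obtain ⟨T, ha, hy, hT⟩ := ih
    refine ⟨insert z T, by simp [ha], by simp,
      ReflTransGen.tail (b := y) (ReflTransGen.mono ?_ _ _ hT) ?_⟩
    · rintro p q ⟨h1, h2, h3⟩
      exact ⟨h1, by simp [h2], by simp [h3]⟩
    · exact ⟨hyz, by simp [hy], by simp⟩

end Konig

/-! ### The partition into strong components and deleted vertices -/

section Parts

variable {V : Type u} {D : Digraph V}

theorem Reach.anti {X Y : Finset V} (h : X ⊆ Y) {a b : V} (hab : D.Reach Y a b) :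
    D.Reach X a b :=
  Relation.ReflTransGen.mono
    (fun _ _ hxy => ⟨fun hx => hxy.1 (h hx), fun hx => hxy.2.1 (h hx), hxy.2.2⟩) _ _ hab

theorem mem_vertexSide (X : Finset V) (v : V) : v ∈ D.vertexSide X v := by
  unfold vertexSide
  split_ifs with h
  · rfl
  · exact ⟨h, .refl, .refl⟩

theorem vertexSide_of_mem {X : Finset V} {v : V} (h : v ∈ X) : D.vertexSide X v = {v} :=
  if_pos h

theorem vertexSide_of_notMem {X : Finset V} {v : V} (h : v ∉ X) :
    D.vertexSide X v = D.strongComponentOf X v :=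
  if_neg h

theorem isStrongComponent_vertexSide {X : Finset V} {v : V} (h : v ∉ X) :
    D.IsStrongComponent X (D.vertexSide X v) :=
  ⟨v, h, vertexSide_of_notMem h⟩

theorem IsStrongComponent.notMem {X : Finset V} {C : Set V} (hC : D.IsStrongComponent X C)
    {v : V} (hv : v ∈ C) : v ∉ X := by
  obtain ⟨w, -, rfl⟩ := hC
  exact hv.1

theorem IsStrongComponent.nonempty {X : Finset V} {C : Set V} (hC : D.IsStrongComponent X C) :
    C.Nonempty := by
  obtain ⟨w, hw, rfl⟩ := hC
  exact ⟨w, hw, .refl, .refl⟩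

theorem IsStrongComponent.eq_vertexSide {X : Finset V} {C : Set V}
    (hC : D.IsStrongComponent X C) {v : V} (hv : v ∈ C) : C = D.vertexSide X v :=
  hC.eq_of_mem (isStrongComponent_vertexSide (hC.notMem hv)) hv (mem_vertexSide X v)

theorem vertexSide_eq_of_mem {X : Finset V} {v w : V} (h : w ∈ D.vertexSide X v) :
    D.vertexSide X w = D.vertexSide X v := by
  by_cases hv : v ∈ X
  · rw [vertexSide_of_mem hv] at h
    rw [Set.mem_singleton_iff.1 h]
  · exact ((isStrongComponent_vertexSide hv).eq_vertexSide h).symm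

theorem vertexSide_anti {X Y : Finset V} (h : X ⊆ Y) (v : V) :
    D.vertexSide Y v ⊆ D.vertexSide X v := by
  by_cases hv : v ∈ Y
  · rw [vertexSide_of_mem hv, Set.singleton_subset_iff]
    exact mem_vertexSide X v
  · rw [vertexSide_of_notMem hv, vertexSide_of_notMem fun hx => hv (h hx)]
    exact fun w hw => ⟨fun hx => hw.1 (h hx), hw.2.1.anti h, hw.2.2.anti h⟩

theorem IsStrongComponent.mem_iff_reach {X : Finset V} {C : Set V}
    (hC : D.IsStrongComponent X C) {a b : V} (ha : a ∈ C) :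
    b ∈ C ↔ D.Reach X a b ∧ D.Reach X b a := by
  have haX := hC.notMem ha
  rw [hC.eq_vertexSide ha, vertexSide_of_notMem haX]
  refine ⟨fun h => h.2, fun h => ⟨?_, h⟩⟩
  rcases h.1.cases_tail with rfl | ⟨c, -, hc⟩
  · exact haX
  · exact hc.2.1

/-- Inside a strong component, every vertex is joined to every other one by a walk that stays in
the component. -/
theorem IsStrongComponent.walk {X : Finset V} {C : Set V} (hC : D.IsStrongComponent X C) {a b : V}
    (ha : a ∈ C) (hb : b ∈ C) :
    Relation.ReflTransGen (fun x y => x ∈ C ∧ y ∈ C ∧ D.Adj x y) a b := by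
  have h := ((hC.mem_iff_reach ha).1 hb).1
  induction h using Relation.ReflTransGen.head_induction_on with
  | refl => exact .refl
  | @head x y hxy hyb ih =>
    have hy : y ∈ C := (hC.mem_iff_reach ha).2
      ⟨.single hxy, hyb.trans ((hC.mem_iff_reach hb).1 ha).1⟩
    exact .head ⟨ha, hy, hxy.2.2⟩ (ih hy)

end Parts

/-! ### Monotone choices of strong components come from ends -/

section Haven

variable {V : Type u} {D : Digraph V} {C : Finset V → Set V}

theorem IsStrongComponent.mem_of_walk {X : Finset V} {K : Set V} (hK : D.IsStrongComponent X K)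
    {r : V → V → Prop} (hr : ∀ x y, r x y → x ∉ X ∧ y ∉ X ∧ D.Adj x y) {a b : V} (ha : a ∈ K)
    (hab : Relation.ReflTransGen r a b) (hba : Relation.ReflTransGen r b a) : b ∈ K :=
  (hK.mem_iff_reach ha).2
    ⟨Relation.ReflTransGen.mono hr _ _ hab, Relation.ReflTransGen.mono hr _ _ hba⟩

/-- `C X` stays strongly connected in `D - Y`, and it meets `C Y` because both contain `C (X ∪ Y)`.
-/
theorem haven_subset_of_disjoint (hC : ∀ X, D.IsStrongComponent X (C X))
    (hanti : ∀ X Y, X ⊆ Y → C Y ⊆ C X) {X Y : Finset V} (hd : ∀ v ∈ C X, v ∉ Y) :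
    C X ⊆ C Y := by
  classical
  obtain ⟨v, hv⟩ := (hC (X ∪ Y)).nonempty
  have hvX := hanti X _ Finset.subset_union_left hv
  have hvY := hanti Y _ Finset.subset_union_right hv
  exact fun w hw => (hC Y).mem_of_walk (fun x y h => ⟨hd x h.1, hd y h.2.1, h.2.2⟩) hvY
    ((hC X).walk hvX hw) ((hC X).walk hw hvX)

/-- The closing-off step: to finite sets `X` and `Y` we can assign a finite set that contains a
vertex of `C X`, the walks in `C X` between vertices of `Y`, and, if possible, a finite set
containing `X` that separates `Y` from the haven. -/
theorem exists_haven_closure (hC : ∀ X, D.IsStrongComponent X (C X)) (X Y : Finset V) :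
    ∃ F : Finset V, (∃ c ∈ C X, c ∈ F) ∧
      (∀ a ∈ Y, ∀ b ∈ Y, a ∈ C X → b ∈ C X → Relation.ReflTransGen
        (fun x y => (x ∈ C X ∧ y ∈ C X ∧ D.Adj x y) ∧ x ∈ F ∧ y ∈ F) a b) ∧
      ((∃ W, X ⊆ W ∧ Disjoint W Y ∧ ∀ v ∈ C W, v ∉ Y) →
        ∃ W, W ⊆ F ∧ X ⊆ W ∧ Disjoint W Y ∧ ∀ v ∈ C W, v ∉ Y) := by
  classical
  obtain ⟨c, hc⟩ := (hC X).nonempty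
  have hT : ∀ a b, ∃ T : Finset V, a ∈ C X → b ∈ C X → Relation.ReflTransGen
      (fun x y => (x ∈ C X ∧ y ∈ C X ∧ D.Adj x y) ∧ x ∈ T ∧ y ∈ T) a b := by
    intro a b
    by_cases h : a ∈ C X ∧ b ∈ C X
    · obtain ⟨T, -, -, hT⟩ := exists_finset_support ((hC X).walk h.1 h.2)
      exact ⟨T, fun _ _ => hT⟩
    · exact ⟨∅, fun ha hb => (h ⟨ha, hb⟩).elim⟩
  choose T hT using hT
  have hW : ∃ W₀ : Finset V, (∃ W, X ⊆ W ∧ Disjoint W Y ∧ ∀ v ∈ C W, v ∉ Y) →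
      X ⊆ W₀ ∧ Disjoint W₀ Y ∧ ∀ v ∈ C W₀, v ∉ Y := by
    by_cases h : ∃ W, X ⊆ W ∧ Disjoint W Y ∧ ∀ v ∈ C W, v ∉ Y
    · exact ⟨h.choose, fun _ => h.choose_spec⟩
    · exact ⟨∅, fun h' => (h h').elim⟩
  obtain ⟨W₀, hW₀⟩ := hW
  refine ⟨insert c (W₀ ∪ (Y ×ˢ Y).biUnion fun p => T p.1 p.2), ⟨c, hc, by simp⟩, ?_,
    fun h => ⟨W₀, fun w hw => by simp [hw], hW₀ h⟩⟩
  intro a ha b hb haC hbC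
  have hsub : ∀ x ∈ T a b, x ∈ insert c (W₀ ∪ (Y ×ˢ Y).biUnion fun p => T p.1 p.2) := by
    intro x hx
    refine Finset.mem_insert_of_mem (Finset.mem_union_right _ (Finset.mem_biUnion.2 ?_))
    exact ⟨(a, b), Finset.mk_mem_product ha hb, hx⟩
  exact Relation.ReflTransGen.mono (fun x y h => ⟨h.1, hsub x h.2.1, hsub y h.2.2⟩) _ _
    (hT a b haC hbC)

theorem exists_closed_sequence (F : Finset V → Finset V → Finset V) :
    ∃ Z : ℕ → Finset V, Monotone Z ∧
      ∀ n X Y, X ⊆ Z n → Y ⊆ Z n → F X Y ⊆ Z (n + 1) := by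
  classical
  let Z : ℕ → Finset V := fun n => Nat.rec ∅
    (fun _ Z => Z ∪ (Z.powerset ×ˢ Z.powerset).biUnion fun p => F p.1 p.2) n
  have hZ : ∀ n, Z (n + 1) =
      Z n ∪ ((Z n).powerset ×ˢ (Z n).powerset).biUnion fun p => F p.1 p.2 := fun _ => rfl
  refine ⟨Z, monotone_nat_of_le_succ fun n => ?_, fun n X Y hX hY v hv => ?_⟩
  · rw [hZ]
    exact Finset.subset_union_left
  · rw [hZ]
    refine Finset.mem_union_right _ (Finset.mem_biUnion.2 ⟨(X, Y), ?_, hv⟩)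
    exact Finset.mk_mem_product (Finset.mem_powerset.2 hX) (Finset.mem_powerset.2 hY)

theorem exists_index_of_finset {Z : ℕ → Finset V} (hZ : Monotone Z) (T : Finset V) :
    ∃ n, ∀ t ∈ T, (∃ m, t ∈ Z m) → t ∈ Z n := by
  classical
  induction T using Finset.induction_on with
  | empty => exact ⟨0, by simp⟩
  | insert a T _ ih =>
    obtain ⟨n, hn⟩ := ih
    by_cases ha : ∃ m, a ∈ Z m
    · obtain ⟨m, hm⟩ := ha
      refine ⟨max n m, fun t ht h => ?_⟩
      rcases Finset.mem_insert.1 ht with rfl | ht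
      · exact hZ (le_max_right _ _) hm
      · exact hZ (le_max_left _ _) (hn t ht h)
    · refine ⟨n, fun t ht h => ?_⟩
      rcases Finset.mem_insert.1 ht with rfl | ht
      · exact (ha h).elim
      · exact hn t ht h

/-- A haven of strong components meets every set that is closed under the operations of
`exists_haven_closure`. -/
theorem exists_mem_closed_sequence (hC : ∀ X, D.IsStrongComponent X (C X))
    (hanti : ∀ X Y, X ⊆ Y → C Y ⊆ C X) {Z : ℕ → Finset V} (hZ : Monotone Z)
    (hpoint : ∀ n X, X ⊆ Z n → ∃ c ∈ C X, c ∈ Z (n + 1))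
    (hsep : ∀ n X Y, X ⊆ Z n → Y ⊆ Z n → (∃ W, X ⊆ W ∧ Disjoint W Y ∧ ∀ v ∈ C W, v ∉ Y) →
      ∃ W, W ⊆ Z (n + 1) ∧ X ⊆ W ∧ Disjoint W Y ∧ ∀ v ∈ C W, v ∉ Y) (X : Finset V) :
    ∃ v ∈ C X, ∃ n, v ∈ Z n := by
  classical
  by_contra! hcon
  -- Only the trace of `X` on the union of the `Z n` is visible to the closure operations. It is
  -- finite, so it lies in a single `Z N`.
  set X₀ := X.filter fun v => ∃ n, v ∈ Z n with hX₀
  have hX₀X : X₀ ⊆ X := Finset.filter_subset _ _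
  obtain ⟨N, hN⟩ := exists_index_of_finset hZ X₀
  have hX₀N : X₀ ⊆ Z N := fun t ht => hN t ht (Finset.mem_filter.1 ht).2
  obtain ⟨x, hx, hxN⟩ := hpoint N X₀ hX₀N
  obtain ⟨v, hv⟩ := (hC X).nonempty
  have hvX₀ := hanti _ _ hX₀X hv
  obtain ⟨T₁, -, -, hT₁⟩ := exists_finset_support ((hC X₀).walk hvX₀ hx)
  obtain ⟨T₂, -, -, hT₂⟩ := exists_finset_support ((hC X₀).walk hx hvX₀)
  obtain ⟨m, hm⟩ := exists_index_of_finset hZ (T₁ ∪ T₂)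
  set n := max m (N + 1) with hn
  have hNn : N ≤ n := by omega
  have hxn : x ∈ Z n := hZ (le_max_right _ _) hxN
  -- By assumption `X` itself separates `Z n \ X₀` from the haven, so some `W` inside `Z (n + 1)`
  -- does too. But the walks between `v` and `x` avoid `W`, which puts `x`, a vertex of `Z n \ X₀`,
  -- into `C W`.
  obtain ⟨W, hWZ, hX₀W, hWd, hCW⟩ := hsep n X₀ (Z n \ X₀) (hX₀N.trans (hZ hNn))
    Finset.sdiff_subset ⟨X, hX₀X, by
      rw [Finset.disjoint_left]
      intro t ht htn
      rw [Finset.mem_sdiff] at htn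
      exact htn.2 (Finset.mem_filter.2 ⟨ht, n, htn.1⟩),
      fun t ht htn => hcon t ht n (Finset.mem_sdiff.1 htn).1⟩
  have hXW : C X ⊆ C W :=
    haven_subset_of_disjoint hC hanti fun t ht htW => hcon t ht _ (hWZ htW)
  have havoid : ∀ t ∈ T₁ ∪ T₂, t ∈ C X₀ → t ∉ W := by
    intro t ht htC htW
    refine Finset.disjoint_left.1 hWd htW (Finset.mem_sdiff.2 ⟨?_, (hC X₀).notMem htC⟩)
    exact hZ (le_max_left _ _) (hm t ht ⟨_, hWZ htW⟩)
  have hxW : x ∈ C W := by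
    refine ((hC W).mem_iff_reach (hXW hv)).2
      ⟨Relation.ReflTransGen.mono ?_ _ _ hT₁, Relation.ReflTransGen.mono ?_ _ _ hT₂⟩
    · rintro y z ⟨⟨h1, h2, h3⟩, h4, h5⟩
      exact ⟨havoid y (Finset.mem_union_left _ h4) h1, havoid z (Finset.mem_union_left _ h5) h2, h3⟩
    · rintro y z ⟨⟨h1, h2, h3⟩, h4, h5⟩
      exact ⟨havoid y (Finset.mem_union_right _ h4) h1,
        havoid z (Finset.mem_union_right _ h5) h2, h3⟩
  exact hCW x hxW (Finset.mem_sdiff.2 ⟨hxn, (hC X₀).notMem hx⟩)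

/-- Points of the successive `C (Z n)` are linked by finite walks. A vertex of `Z N` can lie in `C
(Z n)` only for `n < N`, so the union of these walks is locally finite and any ray in it eventually
leaves each `Z n`. -/
theorem exists_ray_in_closed_sequence (hC : ∀ X, D.IsStrongComponent X (C X))
    (hanti : ∀ X Y, X ⊆ Y → C Y ⊆ C X) {Z : ℕ → Finset V} (hZ : Monotone Z)
    (hpoint : ∀ n X, X ⊆ Z n → ∃ c ∈ C X, c ∈ Z (n + 1))
    (hwalk : ∀ n X, X ⊆ Z n → ∀ a ∈ Z n, ∀ b ∈ Z n, a ∈ C X → b ∈ C X → Relation.ReflTransGen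
        (fun x y => (x ∈ C X ∧ y ∈ C X ∧ D.Adj x y) ∧ x ∈ Z (n + 1) ∧ y ∈ Z (n + 1)) a b) :
    ∃ R : D.Ray, (∀ k, ∃ n, R.vert k ∈ Z n) ∧ ∀ n, R.HasTailIn (C (Z n)) := by
  choose c hcC hcZ using fun n => hpoint n (Z n) subset_rfl
  -- The shift by 3 arises because `c (n + 1)` lies in `Z (n + 2)` and a walk from `c n` to it needs
  -- one more closing-off step.
  let r : V → V → Prop := fun a b =>
    D.Adj a b ∧ ∃ n, (a ∈ C (Z n) ∧ a ∈ Z (n + 3)) ∧ b ∈ C (Z n) ∧ b ∈ Z (n + 3)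
  have hfin : ∀ a, {b | r a b}.Finite := by
    intro a
    by_cases ha : ∃ N, a ∈ Z N
    · obtain ⟨N, hN⟩ := ha
      refine (Z (N + 3)).finite_toSet.subset ?_
      rintro b ⟨-, n, ⟨ha, -⟩, -, hb⟩
      refine hZ ?_ hb
      by_contra hlt
      exact (hC _).notMem ha (hZ (by omega : N ≤ n) hN)
    · refine Set.finite_empty.subset ?_
      rintro b ⟨-, n, ⟨-, ha'⟩, -⟩
      exact ha ⟨_, ha'⟩
  have hstep : ∀ n, Relation.ReflTransGen r (c n) (c (n + 1)) := by
    intro n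
    have h := hwalk (n + 2) (Z n) (hZ (by omega)) (c n) (hZ (by omega) (hcZ n)) (c (n + 1))
      (hcZ (n + 1)) (hcC n) (hanti _ _ (hZ (by omega)) (hcC (n + 1)))
    refine Relation.ReflTransGen.mono ?_ _ _ h
    rintro x y ⟨⟨h1, h2, h3⟩, h4, h5⟩
    exact ⟨h3, n, ⟨h1, h4⟩, h2, h5⟩
  have hreach : ∀ n, Relation.ReflTransGen r (c 0) (c n) := by
    intro n
    induction n with
    | zero => exact .refl
    | succ n ih => exact ih.trans (hstep n)
  have hinj : Function.Injective c := by
    refine Function.Injective.of_lt_imp_ne fun n m h heq => ?_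
    refine (hC _).notMem (hcC m) ?_
    rw [← heq]
    exact hZ (by omega : n + 1 ≤ m) (hcZ n)
  have hinf : {x | Relation.ReflTransGen r (c 0) x}.Infinite :=
    (Set.infinite_range_of_injective hinj).mono (Set.range_subset_iff.2 hreach)
  obtain ⟨f, hf, hadj⟩ := exists_injective_chain hfin hinf
  refine ⟨⟨f, hf, fun n => (hadj n).1⟩, fun k => ?_, fun N => ?_⟩
  · obtain ⟨-, n, ⟨-, h⟩, -⟩ := hadj k
    exact ⟨_, h⟩
  · have hev : ∀ᶠ k in Filter.atTop, f k ∉ Z (N + 3) := by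
      have h := hf.tendsto_cofinite.eventually (Z (N + 3)).finite_toSet.eventually_cofinite_notMem
      rw [Nat.cofinite_eq_atTop] at h
      exact h
    obtain ⟨K, hK⟩ := Filter.eventually_atTop.1 hev
    refine ⟨K, fun k hk => ?_⟩
    obtain ⟨-, n, ⟨h1, h2⟩, -⟩ := hadj k
    refine hanti _ _ (hZ ?_) h1
    by_contra hlt
    exact hK k hk (hZ (by omega) h2)

/-- Every monotone choice of strong components is induced by a solid ray. -/
theorem exists_ray_of_haven (hC : ∀ X, D.IsStrongComponent X (C X))
    (hanti : ∀ X Y, X ⊆ Y → C Y ⊆ C X) : ∃ R : D.Ray, ∀ X, R.HasTailIn (C X) := by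
  classical
  choose F hFpoint hFwalk hFsep using exists_haven_closure hC
  obtain ⟨Z, hZ, hFZ⟩ := exists_closed_sequence F
  have hpoint : ∀ n X, X ⊆ Z n → ∃ c ∈ C X, c ∈ Z (n + 1) := by
    intro n X hX
    obtain ⟨c, hc, hcF⟩ := hFpoint X ∅
    exact ⟨c, hc, hFZ n X ∅ hX (Finset.empty_subset _) hcF⟩
  have hwalk : ∀ n X, X ⊆ Z n → ∀ a ∈ Z n, ∀ b ∈ Z n, a ∈ C X → b ∈ C X →
      Relation.ReflTransGen
        (fun x y => (x ∈ C X ∧ y ∈ C X ∧ D.Adj x y) ∧ x ∈ Z (n + 1) ∧ y ∈ Z (n + 1)) a b := by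
    intro n X hX a ha b hb haC hbC
    have hsub := hFZ n X (Z n) hX subset_rfl
    exact Relation.ReflTransGen.mono (fun x y h => ⟨h.1, hsub h.2.1, hsub h.2.2⟩) _ _
      (hFwalk X (Z n) a ha b hb haC hbC)
  have hsep : ∀ n X Y, X ⊆ Z n → Y ⊆ Z n →
      (∃ W, X ⊆ W ∧ Disjoint W Y ∧ ∀ v ∈ C W, v ∉ Y) →
      ∃ W, W ⊆ Z (n + 1) ∧ X ⊆ W ∧ Disjoint W Y ∧ ∀ v ∈ C W, v ∉ Y := by
    intro n X Y hX hY h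
    obtain ⟨W, hW, h⟩ := hFsep X Y h
    exact ⟨W, hW.trans (hFZ n X Y hX hY), h⟩
  obtain ⟨R, hRZ, hR⟩ := exists_ray_in_closed_sequence hC hanti hZ hpoint hwalk
  refine ⟨R, fun X => ?_⟩
  obtain ⟨p, hpX, n₁, hp⟩ := exists_mem_closed_sequence hC hanti hZ hpoint hsep X
  set X₀ := X.filter fun v => ∃ n, v ∈ Z n with hX₀
  obtain ⟨N, hN⟩ := exists_index_of_finset hZ X₀
  have hX₀N : X₀ ⊆ Z N := fun t ht => hN t ht (Finset.mem_filter.1 ht).2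
  obtain ⟨K, hK⟩ := hR N
  refine ⟨K, fun k hk => ?_⟩
  obtain ⟨n₂, hk₂⟩ := hRZ k
  have hkX₀ : R.vert k ∈ C X₀ := hanti _ _ hX₀N (hK k hk)
  have hpX₀ : p ∈ C X₀ := hanti _ _ (Finset.filter_subset _ _) hpX
  set n := max N (max n₁ n₂) with hn
  have hXn : X₀ ⊆ Z n := hX₀N.trans (hZ (by omega))
  have hpn : p ∈ Z n := hZ (by omega) hp
  have hkn : R.vert k ∈ Z n := hZ (by omega) hk₂
  -- Inside the union of the `Z n`, avoiding `X₀` is the same as avoiding `X`, so walks there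
  -- between `p` and the ray survive in `D - X`.
  have havoid : ∀ t ∈ C X₀, t ∈ Z (n + 1) → t ∉ X := fun t ht htZ htX =>
    (hC X₀).notMem ht (Finset.mem_filter.2 ⟨htX, _, htZ⟩)
  refine (hC X).mem_of_walk ?_ hpX (hwalk n X₀ hXn _ hpn _ hkn hpX₀ hkX₀)
    (hwalk n X₀ hXn _ hkn _ hpn hkX₀ hpX₀)
  rintro x y ⟨⟨h1, h2, h3⟩, h4, h5⟩
  exact ⟨havoid x h1 h4, havoid y h2 h5, h3⟩

/-- Every monotone choice of strong components is induced by an end. -/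
theorem exists_end_of_haven (hC : ∀ X, D.IsStrongComponent X (C X))
    (hanti : ∀ X Y, X ⊆ Y → C Y ⊆ C X) : ∃ ω : D.End, ∀ X, ω.component X = C X := by
  obtain ⟨R, hR⟩ := exists_ray_of_haven hC hanti
  let R' : D.SolidRay := ⟨R, fun X => ⟨C X, hC X, hR X⟩⟩
  refine ⟨Quotient.mk D.solidRaySetoid R', fun X => ?_⟩
  exact Ray.HasTailIn.eq (End.component_spec _ X).1 (hC X)
    ((End.component_spec (Quotient.mk D.solidRaySetoid R') X).2 R' rfl) (hR X)

end Haven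

/-! ### Ends and vertices as points, and bundles between parts -/

section Points

variable {V : Type u} {D : Digraph V}

theorem End.component_anti (ω : D.End) {X Y : Finset V} (h : X ⊆ Y) :
    ω.component Y ⊆ ω.component X := by
  obtain ⟨R, rfl⟩ := Quotient.exists_rep ω
  obtain ⟨hX, hlX⟩ := End.component_spec (Quotient.mk D.solidRaySetoid R) X
  obtain ⟨hY, hlY⟩ := End.component_spec (Quotient.mk D.solidRaySetoid R) Y
  obtain ⟨N, hN⟩ := hlX R rfl
  obtain ⟨M, hM⟩ := hlY R rfl
  have h1 := hX.eq_vertexSide (hN _ (le_max_left N M))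
  have h2 := hY.eq_vertexSide (hM _ (le_max_right N M))
  rw [h1, h2]
  exact vertexSide_anti h _

theorem End.ext_component {ω η : D.End} (h : ∀ X, ω.component X = η.component X) : ω = η := by
  obtain ⟨R, rfl⟩ := Quotient.exists_rep ω
  obtain ⟨S, rfl⟩ := Quotient.exists_rep η
  refine Quotient.sound fun X => ?_
  have h1 := End.component_spec (Quotient.mk D.solidRaySetoid R) X
  have h2 := End.component_spec (Quotient.mk D.solidRaySetoid S) X
  exact ⟨_, h1.1, h1.2 R rfl, by rw [h X]; exact h2.2 S rfl⟩

/-- The possible endpoints of a limit edge: the ends and the vertices of `D`. -/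
abbrev Point (D : Digraph V) : Type u := D.End ⊕ V

/-- The strong component of `D - X`, or the vertex of `X`, in which a point lives. -/
noncomputable def side (p : D.Point) (X : Finset V) : Set V :=
  Sum.elim (fun ω => ω.component X) (fun v => D.vertexSide X v) p

@[simp] theorem side_inl (ω : D.End) (X : Finset V) :
    side (.inl ω : D.Point) X = ω.component X := rfl

@[simp] theorem side_inr (v : V) (X : Finset V) :
    side (.inr v : D.Point) X = D.vertexSide X v := rfl

theorem side_anti (p : D.Point) {X Y : Finset V} (h : X ⊆ Y) : side p Y ⊆ side p X := by
  cases p with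
  | inl ω => exact ω.component_anti h
  | inr v => exact vertexSide_anti h v

theorem side_nonempty (p : D.Point) (X : Finset V) : (side p X).Nonempty := by
  cases p with
  | inl ω => exact (ω.component_spec X).1.nonempty
  | inr v => exact ⟨v, mem_vertexSide X v⟩

theorem side_eq_vertexSide (p : D.Point) {X : Finset V} {v : V} (hv : v ∈ side p X) :
    side p X = D.vertexSide X v := by
  cases p with
  | inl ω => exact (ω.component_spec X).1.eq_vertexSide hv
  | inr w => exact (vertexSide_eq_of_mem hv).symm

theorem vertexSide_eq_component_iff (ω : D.End) (X : Finset V) (v : V) :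
    D.vertexSide X v = ω.component X ↔ v ∈ ω.component X :=
  ⟨fun h => h ▸ mem_vertexSide X v, fun h => ((ω.component_spec X).1.eq_vertexSide h).symm⟩

theorem side_eq_of_side_eq_of_subset {p q : D.Point} {X Y : Finset V} (h : X ⊆ Y)
    (hpq : side p Y = side q Y) : side p X = side q X := by
  obtain ⟨v, hv⟩ := side_nonempty p Y
  rw [side_eq_vertexSide p (side_anti p h hv),
    side_eq_vertexSide q (side_anti q h (hpq ▸ hv))]

theorem ext_side {p q : D.Point} (h : ∀ X, side p X = side q X) : p = q := by
  classical
  have key : ∀ (ω : D.End) (v : V), ω.component {v} ≠ D.vertexSide {v} v := by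
    intro ω v heq
    have hv := (vertexSide_eq_component_iff ω {v} v).1 heq.symm
    exact (ω.component_spec {v}).1.notMem hv (Finset.mem_singleton_self v)
  rcases p with ω | v <;> rcases q with η | w
  · exact congrArg _ (End.ext_component h)
  · exact (key ω w (h {w})).elim
  · exact (key η v (h {v}).symm).elim
  · have := h {v, w}
    rw [side_inr, side_inr, vertexSide_of_mem (by simp), vertexSide_of_mem (by simp)] at this
    exact congrArg _ (Set.singleton_injective this)

theorem exists_side_ne {p q : D.Point} (h : p ≠ q) : ∃ X, side p X ≠ side q X := by
  by_contra! hcon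
  exact h (ext_side hcon)

theorem edgesBetween_mono {A A' B B' : Set V} (hA : A ⊆ A') (hB : B ⊆ B') :
    D.edgesBetween A B ⊆ D.edgesBetween A' B' :=
  fun _ he => ⟨hA he.1, hB he.2.1, he.2.2⟩

/-- A monotone choice of parts, defined on all finite sets containing `X₀`, is induced by a
point. -/
theorem exists_point_of_parts {X₀ : Finset V} {A : Finset V → Set V}
    (hA : ∀ X, X₀ ⊆ X → ∃ v, A X = D.vertexSide X v)
    (hanti : ∀ X Y, X₀ ⊆ X → X ⊆ Y → A Y ⊆ A X) :
    ∃ p : D.Point, ∀ X, X₀ ⊆ X → side p X = A X := by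
  classical
  by_cases h : ∃ v X, X₀ ⊆ X ∧ v ∈ X ∧ v ∈ A X
  · obtain ⟨v, X, hX₀, hvX, hvA⟩ := h
    refine ⟨.inr v, fun Y hY => ?_⟩
    obtain ⟨a, ha⟩ := hA X hX₀
    have hAX : A X = {v} := by
      rw [ha] at hvA
      rw [ha, ← vertexSide_eq_of_mem hvA, vertexSide_of_mem hvX]
    have hXY : X₀ ⊆ X ∪ Y := hX₀.trans Finset.subset_union_left
    obtain ⟨b, hb⟩ := hA (X ∪ Y) hXY
    have hbA : b ∈ A (X ∪ Y) := hb ▸ mem_vertexSide _ b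
    have hbv : b = v := by
      have := hanti X _ hX₀ Finset.subset_union_left hbA
      rwa [hAX] at this
    have hvY : v ∈ A Y := hbv ▸ hanti Y _ hY Finset.subset_union_right hbA
    obtain ⟨c, hc⟩ := hA Y hY
    rw [hc] at hvY ⊢
    exact vertexSide_eq_of_mem hvY
  · push Not at h
    choose a ha using fun X : Finset V => hA (X ∪ X₀) Finset.subset_union_right
    have haA : ∀ X, a X ∈ A (X ∪ X₀) := fun X => ha X ▸ mem_vertexSide _ _
    have hanotin : ∀ X, a X ∉ X := fun X hX =>
      h (a X) (X ∪ X₀) Finset.subset_union_right (Finset.mem_union_left _ hX) (haA X)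
    -- No part `A X` is a deleted vertex, so they are all strong components. Choosing `a X` in `A (X
    -- ∪ X₀)` extends the family to sets that do not contain `X₀`.
    obtain ⟨ω, hω⟩ := exists_end_of_haven (C := fun X => D.vertexSide X (a X))
      (fun X => isStrongComponent_vertexSide (hanotin X)) (by
        intro X Y hXY
        have h1 : a Y ∈ D.vertexSide X (a X) := by
          have := hanti (X ∪ X₀) (Y ∪ X₀) Finset.subset_union_right
            (Finset.union_subset_union_left hXY) (haA Y)
          rw [ha X] at this
          exact vertexSide_anti Finset.subset_union_left _ this
        rw [← vertexSide_eq_of_mem h1]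
        exact vertexSide_anti hXY _)
    refine ⟨.inl ω, fun X hX => ?_⟩
    have := ha X
    rw [Finset.union_eq_left.2 hX] at this
    rw [side_inl, hω, this]

/-- This merges the three kinds of bundle into one: two different parts, not both deleted vertices.
-/
theorem isBundle_iff {X : Finset V} {F : Set (V × V)} :
    D.IsBundle X F ↔ F.Nonempty ∧ ∃ a b, D.vertexSide X a ≠ D.vertexSide X b ∧
      ¬ (a ∈ X ∧ b ∈ X) ∧ F = D.edgesBetween (D.vertexSide X a) (D.vertexSide X b) := by
  refine and_congr_right fun _ => ⟨?_, ?_⟩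
  · have hne : ∀ (v : V) (C : Set V), v ∈ X → D.IsStrongComponent X C → D.vertexSide X v ≠ C :=
      fun v C hv hC h => hC.notMem (h ▸ mem_vertexSide X v) hv
    rintro (⟨C, C', hC, hC', hne', rfl⟩ | ⟨v, C, hv, hC, rfl⟩ | ⟨C, v, hv, hC, rfl⟩)
    · obtain ⟨a, ha⟩ := hC.nonempty
      obtain ⟨b, hb⟩ := hC'.nonempty
      refine ⟨a, b, ?_, fun h => hC.notMem ha h.1, ?_⟩ <;>
        rw [← hC.eq_vertexSide ha, ← hC'.eq_vertexSide hb]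
      exact hne'
    · obtain ⟨b, hb⟩ := hC.nonempty
      refine ⟨v, b, ?_, fun h => hC.notMem hb h.2, ?_⟩ <;> rw [← hC.eq_vertexSide hb]
      · exact hne v C hv hC
      · rw [vertexSide_of_mem hv]
    · obtain ⟨a, ha⟩ := hC.nonempty
      refine ⟨a, v, ?_, fun h => hC.notMem ha h.1, ?_⟩ <;> rw [← hC.eq_vertexSide ha]
      · exact (hne v C hv hC).symm
      · rw [vertexSide_of_mem hv]
  · rintro ⟨a, b, hab, hX, rfl⟩
    by_cases ha : a ∈ X
    · have hb : b ∉ X := fun hb => hX ⟨ha, hb⟩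
      exact .inr (.inl ⟨a, _, ha, isStrongComponent_vertexSide hb, by rw [vertexSide_of_mem ha]⟩)
    · by_cases hb : b ∈ X
      · exact .inr (.inr ⟨_, b, hb, isStrongComponent_vertexSide ha,
          by rw [vertexSide_of_mem hb]⟩)
      · exact .inl ⟨_, _, isStrongComponent_vertexSide ha, isStrongComponent_vertexSide hb, hab,
          rfl⟩

end Points

/-! ### Limit edges as pairs of points; injectivity -/

section LimitEdges

variable {V : Type u} {D : Digraph V}

/-- The first point of a limit edge. -/
def LimitEdge.source : D.LimitEdge → D.Point
  | .endEnd ω _ _ _ => .inl ω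
  | .vertexEnd v _ _ => .inr v
  | .endVertex ω _ _ => .inl ω

/-- The last point of a limit edge. -/
def LimitEdge.target : D.LimitEdge → D.Point
  | .endEnd _ η _ _ => .inl η
  | .vertexEnd _ ω _ => .inl ω
  | .endVertex _ v _ => .inr v

theorem LimitEdge.ext_points {l m : D.LimitEdge} (hs : l.source = m.source)
    (ht : l.target = m.target) : l = m := by
  cases l <;> cases m <;> simp_all [source, target]

theorem LimitEdge.source_ne_target (l : D.LimitEdge) : l.source ≠ l.target := by
  cases l <;> simp_all [source, target]

theorem LimitEdge.exists_end (l : D.LimitEdge) :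
    (∃ ω, l.source = .inl ω) ∨ ∃ ω, l.target = .inl ω := by
  cases l <;> simp [source, target]

open Classical in
theorem LimitEdge.direction_eq (l : D.LimitEdge) (X : Finset V) :
    l.direction X = if side l.source X = side l.target X then .component (side l.source X)
      else .bundle (D.edgesBetween (side l.source X) (side l.target X)) := by
  cases l with
  | endEnd ω η hne h =>
    by_cases hX : ω.component X = η.component X
    · exact (if_neg (not_not.2 hX)).trans (if_pos hX).symm
    · exact (if_pos hX).trans (if_neg hX).symm
  | vertexEnd v ω h =>
    simp only [direction, source, target, side_inl, side_inr, vertexSide_eq_component_iff]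
    split_ifs with hv
    · rw [(vertexSide_eq_component_iff ω X v).2 hv]
    · rfl
  | endVertex ω v h =>
    simp only [direction, source, target, side_inl, side_inr,
      eq_comm (a := ω.component X) (b := D.vertexSide X v), vertexSide_eq_component_iff]

theorem LimitEdge.edgesBetween_nonempty (l : D.LimitEdge) {X : Finset V}
    (h : side l.source X ≠ side l.target X) :
    (D.edgesBetween (side l.source X) (side l.target X)).Nonempty := by
  cases l with
  | endEnd ω η hne hl => exact hl X h
  | vertexEnd v ω hl =>
    refine (hl X fun hv => h ((vertexSide_eq_component_iff ω X v).2 hv)).mono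
      (edgesBetween_mono ?_ subset_rfl)
    exact Set.singleton_subset_iff.2 (mem_vertexSide X v)
  | endVertex ω v hl =>
    refine (hl X fun hv => h ((vertexSide_eq_component_iff ω X v).2 hv).symm).mono
      (edgesBetween_mono subset_rfl ?_)
    exact Set.singleton_subset_iff.2 (mem_vertexSide X v)

/-- Two points that are joined by edges in every separation, and are not both vertices, are the
endpoints of a limit edge. -/
theorem LimitEdge.exists_of_points {p q : D.Point} (hne : p ≠ q)
    (hend : (∃ ω, p = .inl ω) ∨ ∃ ω, q = .inl ω)
    (h : ∀ X, side p X ≠ side q X → (D.edgesBetween (side p X) (side q X)).Nonempty) :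
    ∃ l : D.LimitEdge, l.source = p ∧ l.target = q := by
  classical
  have hnotMem : ∀ (ω : D.End) (X : Finset V) (v : V), v ∉ ω.component (insert v X) :=
    fun ω X v hv => (ω.component_spec _).1.notMem hv (Finset.mem_insert_self v X)
  rcases p with ω | v <;> rcases q with η | w
  · exact ⟨.endEnd ω η (fun h => hne (congrArg _ h)) h, rfl, rfl⟩
  · refine ⟨.endVertex ω w fun X _ => ?_, rfl, rfl⟩
    -- Deleting `w` as well shrinks its part to `{w}`, as the definition of a limit edge demands;
    -- the edge found there still counts for `X`.
    have hX := h (insert w X) fun heq =>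
      hnotMem ω X w ((vertexSide_eq_component_iff ω _ w).1 heq.symm)
    rw [side_inr, vertexSide_of_mem (Finset.mem_insert_self w X)] at hX
    exact hX.mono (edgesBetween_mono (ω.component_anti (Finset.subset_insert _ _)) subset_rfl)
  · refine ⟨.vertexEnd v η fun X _ => ?_, rfl, rfl⟩
    have hX := h (insert v X) fun heq =>
      hnotMem η X v ((vertexSide_eq_component_iff η _ v).1 heq)
    rw [side_inr, vertexSide_of_mem (Finset.mem_insert_self v X)] at hX
    exact hX.mono (edgesBetween_mono subset_rfl (η.component_anti (Finset.subset_insert _ _)))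
  · simp at hend

theorem LimitEdge.direction_mem (l : D.LimitEdge) : l.direction ∈ D.edgeDirections := by
  classical
  refine ⟨⟨fun X => ?_, fun X Y hXY => ?_⟩, ?_⟩
  · rw [l.direction_eq]
    split_ifs with h
    · change D.IsStrongComponent X (side l.source X)
      rcases l.exists_end with ⟨ω, hω⟩ | ⟨ω, hω⟩
      · rw [hω]
        exact (ω.component_spec X).1
      · rw [h, hω]
        exact (ω.component_spec X).1
    · refine isBundle_iff.2 ⟨l.edgesBetween_nonempty h, ?_⟩
      obtain ⟨a, ha⟩ := side_nonempty l.source X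
      obtain ⟨b, hb⟩ := side_nonempty l.target X
      refine ⟨a, b, ?_, ?_, ?_⟩
      · rwa [← side_eq_vertexSide _ ha, ← side_eq_vertexSide _ hb]
      · rintro ⟨haX, hbX⟩
        rcases l.exists_end with ⟨ω, hω⟩ | ⟨ω, hω⟩
        · rw [hω] at ha
          exact (ω.component_spec X).1.notMem ha haX
        · rw [hω] at hb
          exact (ω.component_spec X).1.notMem hb hbX
      · rw [← side_eq_vertexSide _ ha, ← side_eq_vertexSide _ hb]
  · rw [l.direction_eq, l.direction_eq]
    have hs := side_anti l.source hXY
    have ht := side_anti l.target hXY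
    split_ifs with hX hY hY
    · exact hs
    · exact edgesBetween_mono hs (hX ▸ ht)
    · exact (hX (side_eq_of_side_eq_of_subset hXY hY)).elim
    · exact edgesBetween_mono hs ht
  · obtain ⟨X, hX⟩ := exists_side_ne l.source_ne_target
    exact ⟨X, _, by rw [l.direction_eq, if_neg hX]⟩

theorem LimitEdge.direction_injective :
    Function.Injective (fun l : D.LimitEdge => l.direction) := by
  classical
  intro l m (hlm : l.direction = m.direction)
  obtain ⟨X₀, hX₀⟩ := exists_side_ne l.source_ne_target
  have key : ∀ X, side l.source X = side m.source X ∧ side l.target X = side m.target X := by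
    intro X
    have hne : side l.source (X ∪ X₀) ≠ side l.target (X ∪ X₀) := fun h =>
      hX₀ (side_eq_of_side_eq_of_subset Finset.subset_union_right h)
    have h := congrFun hlm (X ∪ X₀)
    rw [l.direction_eq, m.direction_eq, if_neg hne] at h
    split_ifs at h with hm
    obtain ⟨e, he⟩ := l.edgesBetween_nonempty hne
    have he' := he
    rw [DirectionValue.bundle.inj h] at he'
    constructor
    · refine side_eq_of_side_eq_of_subset (Y := X ∪ X₀) Finset.subset_union_left ?_
      rw [side_eq_vertexSide _ he.1, side_eq_vertexSide _ he'.1]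
    · refine side_eq_of_side_eq_of_subset (Y := X ∪ X₀) Finset.subset_union_left ?_
      rw [side_eq_vertexSide _ he.2.1, side_eq_vertexSide _ he'.2.1]
  exact ext_points (ext_side fun X => (key X).1) (ext_side fun X => (key X).2)

end LimitEdges

/-! ### Every edge-direction comes from a limit edge -/

section EdgeDirections

variable {V : Type u} {D : Digraph V}

theorem IsStrongComponent.edgesBetween_nonempty {X : Finset V} {C : Set V}
    (hC : D.IsStrongComponent X C) {a b : V} (ha : a ∈ C) (hb : b ∈ C) (hab : a ≠ b) :
    (D.edgesBetween C C).Nonempty := by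
  rcases (hC.walk ha hb).cases_head with h | ⟨c, hc, -⟩
  · exact (hab h).elim
  · exact ⟨(a, c), hc⟩

/-- The strong components that are values of a direction have edges. -/
theorem IsDirection.edgesBetween_nonempty {f : Finset V → DirectionValue V} (hf : D.IsDirection f)
    {X : Finset V} {C : Set V} (h : f X = .component C) : (D.edgesBetween C C).Nonempty := by
  classical
  have hC : D.IsStrongComponent X C := by simpa [h, IsComponentOrBundle] using hf.1 X
  obtain ⟨w, hw⟩ := hC.nonempty
  -- After deleting `w` in `C`, the new value is either a component with a second vertex of `C` or a
  -- non-empty bundle inside `C`.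
  have hY := hf.1 (insert w X)
  have hc := hf.2 X (insert w X) (Finset.subset_insert w X)
  rw [h] at hc
  cases hval : f (insert w X) with
  | component C' =>
    rw [hval] at hY hc
    obtain ⟨x, hx⟩ := IsStrongComponent.nonempty hY
    refine hC.edgesBetween_nonempty hw (hc hx) ?_
    rintro rfl
    exact IsStrongComponent.notMem hY hx (Finset.mem_insert_self _ X)
  | bundle F =>
    rw [hval] at hY hc
    exact Set.Nonempty.mono hc hY.1

/-- A component value has an edge, and both ends of that edge lie in one part of the coarser
partition, whereas the edges of a bundle join different parts. Without an edge the containment would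
hold vacuously. -/
theorem IsDirection.exists_bundle_of_subset {f : Finset V → DirectionValue V}
    (hf : D.IsDirection f) {X Y : Finset V} (hXY : X ⊆ Y) {F : Set (V × V)}
    (hX : f X = .bundle F) : ∃ F', f Y = .bundle F' := by
  cases hY : f Y with
  | bundle F' => exact ⟨F', rfl⟩
  | component C =>
    exfalso
    obtain ⟨e, he⟩ := hf.edgesBetween_nonempty hY
    have hF : D.IsBundle X F := by simpa [hX, IsComponentOrBundle] using hf.1 X
    have hC : D.IsStrongComponent Y C := by simpa [hY, IsComponentOrBundle] using hf.1 Y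
    have hc : D.edgesBetween C C ⊆ F := by simpa [hX, hY, Contains] using hf.2 X Y hXY
    obtain ⟨-, a, b, hab, -, rfl⟩ := isBundle_iff.1 hF
    have he' := hc he
    refine hab ?_
    rw [← vertexSide_eq_of_mem he'.1, ← vertexSide_eq_of_mem he'.2.1]
    refine (vertexSide_eq_of_mem (vertexSide_anti hXY _ ?_)).symm
    rw [← hC.eq_vertexSide he.1]
    exact he.2.1

theorem IsDirection.exists_limitEdge {f : Finset V → DirectionValue V} (hf : D.IsDirection f)
    {X₀ : Finset V} {F₀ : Set (V × V)} (hX₀ : f X₀ = .bundle F₀) :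
    ∃ l : D.LimitEdge, l.direction = f := by
  classical
  have hparts : ∀ X, ∃ a b, X₀ ⊆ X →
      (D.edgesBetween (D.vertexSide X a) (D.vertexSide X b)).Nonempty ∧
      D.vertexSide X a ≠ D.vertexSide X b ∧ ¬ (a ∈ X ∧ b ∈ X) ∧
      f X = .bundle (D.edgesBetween (D.vertexSide X a) (D.vertexSide X b)) := by
    intro X
    by_cases hX : X₀ ⊆ X
    · obtain ⟨F, hF⟩ := hf.exists_bundle_of_subset hX hX₀
      have hb : D.IsBundle X F := by simpa [hF, IsComponentOrBundle] using hf.1 X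
      obtain ⟨hne, a, b, hab, habX, rfl⟩ := isBundle_iff.1 hb
      exact ⟨a, b, fun _ => ⟨hne, hab, habX, hF⟩⟩
    -- For other `X` the choice is irrelevant; an edge of `F₀` merely supplies some vertex.
    · obtain ⟨e, -⟩ : F₀.Nonempty := by
        have hb : D.IsBundle X₀ F₀ := by simpa [hX₀, IsComponentOrBundle] using hf.1 X₀
        exact hb.1
      exact ⟨e.1, e.1, fun h => (hX h).elim⟩
  choose a b hab using hparts
  have hsub : ∀ X Y, X₀ ⊆ X → X ⊆ Y →
      D.vertexSide Y (a Y) ⊆ D.vertexSide X (a X) ∧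
      D.vertexSide Y (b Y) ⊆ D.vertexSide X (b X) := by
    intro X Y hX hXY
    obtain ⟨-, -, -, hfX⟩ := hab X hX
    obtain ⟨⟨e, he⟩, -, -, hfY⟩ := hab Y (hX.trans hXY)
    have hc := hf.2 X Y hXY
    rw [hfX, hfY] at hc
    have he' := hc he
    rw [← vertexSide_eq_of_mem he.1, ← vertexSide_eq_of_mem he'.1,
      ← vertexSide_eq_of_mem he.2.1, ← vertexSide_eq_of_mem he'.2.1]
    exact ⟨vertexSide_anti hXY _, vertexSide_anti hXY _⟩
  obtain ⟨p, hp⟩ := exists_point_of_parts (D := D) (X₀ := X₀)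
    (A := fun X => D.vertexSide X (a X)) (fun X _ => ⟨_, rfl⟩) fun X Y hX h => (hsub X Y hX h).1
  obtain ⟨q, hq⟩ := exists_point_of_parts (D := D) (X₀ := X₀)
    (A := fun X => D.vertexSide X (b X)) (fun X _ => ⟨_, rfl⟩) fun X Y hX h => (hsub X Y hX h).2
  have hne : p ≠ q := by
    rintro rfl
    exact (hab X₀ subset_rfl).2.1 ((hp X₀ subset_rfl).symm.trans (hq X₀ subset_rfl))
  have hend : (∃ ω, p = .inl ω) ∨ ∃ ω, q = .inl ω := by
    rcases p with ω | v
    · exact .inl ⟨ω, rfl⟩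
    rcases q with η | w
    · exact .inr ⟨η, rfl⟩
    exfalso
    -- If both points were vertices, deleting both would give a bundle between two deleted vertices.
    have hY : X₀ ⊆ X₀ ∪ {v, w} := Finset.subset_union_left
    have hv : v ∈ X₀ ∪ {v, w} := by simp
    have hw : w ∈ X₀ ∪ {v, w} := by simp
    have h1 : a (X₀ ∪ {v, w}) ∈ ({v} : Set V) := by
      rw [← vertexSide_of_mem (D := D) hv, ← side_inr, hp _ hY]
      exact mem_vertexSide _ _
    have h2 : b (X₀ ∪ {v, w}) ∈ ({w} : Set V) := by
      rw [← vertexSide_of_mem (D := D) hw, ← side_inr, hq _ hY]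
      exact mem_vertexSide _ _
    refine (hab _ hY).2.2.1 ⟨?_, ?_⟩
    · rw [Set.mem_singleton_iff.1 h1]
      exact hv
    · rw [Set.mem_singleton_iff.1 h2]
      exact hw
  have hedge : ∀ X, ∃ e, e ∈ D.edgesBetween (side p (X ∪ X₀)) (side q (X ∪ X₀)) ∧
      f (X ∪ X₀) = .bundle (D.edgesBetween (side p (X ∪ X₀)) (side q (X ∪ X₀))) := by
    intro X
    rw [hp _ Finset.subset_union_right, hq _ Finset.subset_union_right]
    obtain ⟨⟨e, he⟩, -, -, hfX⟩ := hab (X ∪ X₀) Finset.subset_union_right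
    exact ⟨e, he, hfX⟩
  obtain ⟨l, rfl, rfl⟩ := LimitEdge.exists_of_points hne hend fun X _ => by
    obtain ⟨e, he, -⟩ := hedge X
    exact ⟨e, edgesBetween_mono (side_anti p Finset.subset_union_left)
      (side_anti q Finset.subset_union_left) he⟩
  refine ⟨l, funext fun X => ?_⟩
  obtain ⟨e, he, hfe⟩ := hedge X
  -- The edge `e` of the bundle at `X ∪ X₀` also lies in `f X`, and the parts containing its two
  -- ends determine `f X`.
  have hc := hf.2 X (X ∪ X₀) Finset.subset_union_left
  rw [hfe] at hc
  have hs := side_eq_vertexSide _ (side_anti l.source Finset.subset_union_left he.1)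
  have ht := side_eq_vertexSide _ (side_anti l.target Finset.subset_union_left he.2.1)
  have hX := hf.1 X
  rw [l.direction_eq]
  cases hval : f X with
  | component C =>
    rw [hval] at hc hX
    have he' := hc he
    have h1 := IsStrongComponent.eq_vertexSide hX he'.1
    have h2 := IsStrongComponent.eq_vertexSide hX he'.2.1
    rw [hs, ht, ← h1, ← h2, if_pos rfl]
  | bundle F =>
    rw [hval] at hc hX
    obtain ⟨-, c, d, hcd, -, rfl⟩ := isBundle_iff.1 hX
    have he' := hc he
    rw [hs, ht, vertexSide_eq_of_mem he'.1, vertexSide_eq_of_mem he'.2.1, if_neg hcd]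

end EdgeDirections

end Digraph

theorem mainTheorem2 {V : Type*} [Infinite V] (D : Digraph V)
    (hD : ∀ v, ¬ D.Adj v v) :
    Set.BijOn (fun l : D.LimitEdge => l.direction) Set.univ D.edgeDirections := by
  refine ⟨fun l _ => l.direction_mem, Digraph.LimitEdge.direction_injective.injOn, ?_⟩
  rintro f ⟨hf, X, F, hX⟩
  obtain ⟨l, rfl⟩ := hf.exists_limitEdge hX
  exact ⟨l, Set.mem_univ l, rfl⟩
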